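/- Let $\mathbb{T}=\{z\in\mathbb{C}:|z|=1\}$ and, for $a\in\mathbb{R}$, let $\|a\|=\inf_{k\in\mathbb{Z}}|a-k|$. A vector $(\varphi_1,\varphi_2)\in\mathbb{R}^2$ is called of finite type if there are constants $K>0$ and $\gamma\ge 1$ such that $\|q_1\varphi_1+q_2\varphi_2\|\ge K/\max(|q_1|,|q_2|)^{\gamma}$ for all $(q_1,q_2)\in\mathbb{Z}^2\setminus\{0\}$. Let $\arg\in(-\pi,\pi]$ denote the principal argument. Let $f_1,f_2:\mathbb{T}\to\mathbb{C}$ be real analytic functions all of whose zeros are roots of unity, and let $x_1=e^{2\pi i\varphi_1}$, $x_2=e^{2\pi i\varphi_2}$ with $(\varphi_1,\varphi_2)$ of finite type. Then $f_j(x_j^n)\neq 0$ for all $n\ge1$, and $\log|f_j(x_j^n)|=O(\log n)$ as $n\to\infty$, for $j\in\{1,2\}$. Moreover, for each of the four choices $(L_1,L_2)$ with $L_j\in\{\log|f_j|,\ \arg f_j\}$, the function $(u,v)\mapsto L_1(e^{2\pi iu})L_2(e^{2\pi iv})$ is integrable on $[0,1]^2$ and, as $n\to\infty$, $$\frac1n\sum_{m=1}^n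 L_1(x_1^m)\,L_2(x_2^m)\longrightarrow\int_{[0,1]^2}L_1(e^{2\pi iu})\,L_2(e^{2\pi iv})\,du\,dv .$$ -/

import Mathlib

open Filter Topology MeasureTheory

/-- The point `e^{2πit}` of the unit circle. -/
noncomputable def unitExp (t : ℝ) : Circle := Circle.exp (2 * Real.pi * t)

/-- A function on the unit circle is real analytic if it is real analytic in the angle. -/
def IsRealAnalyticOnCircle (f : Circle → ℂ) : Prop :=
  AnalyticOnNhd ℝ (fun t : ℝ => f (unitExp t)) Set.univ

/-- All zeros of `f` on the unit circle are roots of unity. -/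
def ZerosAreRootsOfUnity (f : Circle → ℂ) : Prop :=
  ∀ z : Circle, f z = 0 → ∃ k : ℕ, 0 < k ∧ z ^ k = 1

/-- The distance of a real number to the nearest integer. -/
noncomputable def distToInt (a : ℝ) : ℝ := ⨅ n : ℤ, |a - (n : ℝ)|

/-- A real vector `φ` is of finite type if `‖q · φ‖ ≥ K / |q|_∞ ^ γ` for all nonzero integer
vectors `q`, with constants `K > 0` and `γ ≥ 1`. Here `‖q‖` is the maximum norm of `q`. The
condition depends only on `φ` modulo integer vectors, that is, on the points `e^{2πi φ_j}`. -/
def IsFiniteType {d : ℕ} (φ : Fin d → ℝ) : Prop :=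
  ∃ K γ : ℝ, 0 < K ∧ 1 ≤ γ ∧ ∀ q : Fin d → ℤ, q ≠ 0 →
    K / ‖q‖ ^ γ ≤ distToInt (∑ j, (q j : ℝ) * φ j)

/-- The closed unit square `[0,1]²`. -/
def unitSquare : Set (ℝ × ℝ) := Set.Icc (0 : ℝ) 1 ×ˢ Set.Icc (0 : ℝ) 1

/-- For real functions `g₁, g₂` on the circle and points `x₁, x₂`, the function
`(u, v) ↦ g₁(e^{2πiu}) g₂(e^{2πiv})` is integrable on the unit square, and the averages
`(1/n) ∑_{m=1}^n g₁(x₁^m) g₂(x₂^m)` converge to its integral over the unit square. -/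
def AverageConvergesToIntegral (g₁ g₂ : Circle → ℝ) (x₁ x₂ : Circle) : Prop :=
  IntegrableOn (fun p : ℝ × ℝ => g₁ (unitExp p.1) * g₂ (unitExp p.2)) unitSquare ∧
  Tendsto (fun n : ℕ => (1 / (n : ℝ)) * ∑ m ∈ Finset.Icc 1 n, g₁ (x₁ ^ m) * g₂ (x₂ ^ m)) atTop
    (𝓝 (∫ p in unitSquare, g₁ (unitExp p.1) * g₂ (unitExp p.2)))

/-! Finite type is used twice. It excludes every relation `x₁ ^ a * x₂ ^ b = 1` with `(a, b) ≠ 0`,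
so by Weyl's criterion the points `(x₁ ^ m, x₂ ^ m)` equidistribute on the torus. It also makes each
`x_j` Diophantine: `‖x_j ^ n - 1‖` is at least a negative power of `n`.

Equidistribution handles only continuous functions, while `log |f|` is unbounded and `arg f` may
jump. Both are continuous off finitely many points, so a product can be cut off near a closed null
set. The error is small uniformly in the length of the average once second moments along the orbit
are bounded (`IsEquidistributed.integrable_and_tendsto`); for a product, bounded fourth moments of
the factors suffice.

For `arg` these are trivial. By compactness and local factorization, `|log ‖f z‖|` is at most a
constant plus a finite sum of `|log ‖z - a‖|` over zeros `a` of `f`, which are roots of unity. By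
pigeonhole, any `j` indices up to `n` include two at distance `O(n / j)`, so the Diophantine bound
forces some `‖x ^ m - a‖` among them to be at least `c * (j / n) ^ γ`. Hence the fourth moment sum
is bounded by a sum over `j` of fourth powers of `O(1 + log (n / j))`, which is `O(n)`. The case `j
= 1` gives the growth bound `O(log n)`. -/

/-! ### Equidistribution against functions with bounded second moments -/

section Equidistribution

/-- The mean value `(1/n) ∑_{m=1}^n g(p_m)` of `g` along the sequence `p`. -/
noncomputable def empiricalMean {X : Type*} (p : ℕ → X) (g : X → ℝ) (n : ℕ) : ℝ :=
  (1 / (n : ℝ)) * ∑ m ∈ Finset.Icc 1 n, g (p m)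

theorem empiricalMean_add {X : Type*} (p : ℕ → X) (g h : X → ℝ) (n : ℕ) :
    empiricalMean p (fun x => g x + h x) n = empiricalMean p g n + empiricalMean p h n := by
  simp only [empiricalMean, Finset.sum_add_distrib, mul_add]

theorem empiricalMean_sub {X : Type*} (p : ℕ → X) (g h : X → ℝ) (n : ℕ) :
    empiricalMean p (fun x => g x - h x) n = empiricalMean p g n - empiricalMean p h n := by
  simp only [empiricalMean, Finset.sum_sub_distrib, mul_sub]

theorem empiricalMean_const_mul {X : Type*} (p : ℕ → X) (c : ℝ) (g : X → ℝ) (n : ℕ) :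
    empiricalMean p (fun x => c * g x) n = c * empiricalMean p g n := by
  simp only [empiricalMean, ← Finset.mul_sum]; ring

theorem empiricalMean_mono {X : Type*} (p : ℕ → X) {g h : X → ℝ} (hgh : ∀ x, g x ≤ h x) (n : ℕ) :
    empiricalMean p g n ≤ empiricalMean p h n :=
  mul_le_mul_of_nonneg_left (Finset.sum_le_sum fun m _ => hgh (p m)) (by positivity)

theorem abs_empiricalMean_le {X : Type*} (p : ℕ → X) (g : X → ℝ) (n : ℕ) :
    |empiricalMean p g n| ≤ empiricalMean p (fun x => |g x|) n := by
  rw [empiricalMean, abs_mul, abs_of_nonneg (by positivity : (0 : ℝ) ≤ 1 / n)]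
  exact mul_le_mul_of_nonneg_left (Finset.abs_sum_le_sum_abs _ _) (by positivity)

/-- The sequence `p` is equidistributed with respect to the measure `μ`. -/
def IsEquidistributed {X : Type*} [TopologicalSpace X] [MeasurableSpace X]
    (p : ℕ → X) (μ : Measure X) : Prop :=
  ∀ h : X → ℝ, Continuous h → Tendsto (empiricalMean p h) atTop (𝓝 (∫ x, h x ∂μ))

/-- A continuous function of `t` that vanishes for `k * t ≤ 1` and is `1` for `k * t ≥ 2`. -/
noncomputable def cutoff (k : ℕ) (t : ℝ) : ℝ := min 1 (max 0 (k * t - 1))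

theorem continuous_cutoff (k : ℕ) : Continuous (cutoff k) := by unfold cutoff; fun_prop

theorem cutoff_nonneg (k : ℕ) (t : ℝ) : 0 ≤ cutoff k t := by simp [cutoff]

theorem cutoff_le_one (k : ℕ) (t : ℝ) : cutoff k t ≤ 1 := by simp [cutoff]

theorem cutoff_eq_zero {k : ℕ} {t : ℝ} (h : k * t ≤ 1) : cutoff k t = 0 := by
  simp [cutoff, max_eq_left (sub_nonpos.2 h)]

theorem tendsto_cutoff {t : ℝ} (ht : 0 < t) : Tendsto (fun k => cutoff k t) atTop (𝓝 1) := by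
  refine tendsto_const_nhds.congr' ?_
  filter_upwards [(tendsto_natCast_atTop_atTop.atTop_mul_const ht).eventually_ge_atTop 2] with k hk
  rw [cutoff, max_eq_right (by linarith), min_eq_left (by linarith)]

/-- Near a zero of `ρ` the cutoff vanishes identically, so the behaviour of `G` there is irrelevant.
-/
theorem continuous_cutoff_mul {X : Type*} [TopologicalSpace X] {ρ G : X → ℝ} (hρ : Continuous ρ)
    (hG : ∀ x, ρ x ≠ 0 → ContinuousAt G x) (k : ℕ) :
    Continuous (fun x => cutoff k (ρ x) * G x) := by
  rw [continuous_iff_continuousAt]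
  intro x
  by_cases hx : ρ x = 0
  · have h0 : ∀ᶠ y in 𝓝 x, (k : ℝ) * ρ y < 1 :=
      (continuous_const.mul hρ).continuousAt.eventually_lt_const (by simp [hx])
    refine (continuousAt_const (y := (0 : ℝ))).congr ?_
    filter_upwards [h0] with y hy
    rw [cutoff_eq_zero hy.le, zero_mul]
  · exact ((continuous_cutoff k).comp hρ).continuousAt.mul (hG x hx)

variable {X : Type*} [TopologicalSpace X] [CompactSpace X] [MeasurableSpace X] [BorelSpace X]

theorem Continuous.integrable_of_compactSpace {μ : Measure X} [IsFiniteMeasure μ] {h : X → ℝ}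
    (hh : Continuous h) : Integrable h μ :=
  hh.integrable_of_hasCompactSupport (HasCompactSupport.of_compactSpace h)

/-- Means of a function with bounded second moments along an equidistributed sequence converge
to its integral, provided that the function is continuous off a closed null set. -/
theorem IsEquidistributed.integrable_and_tendsto {μ : Measure X} [IsProbabilityMeasure μ]
    {p : ℕ → X} (hp : IsEquidistributed p μ) {ρ G : X → ℝ} (hρ : Continuous ρ)
    (hρ0 : ∀ x, 0 ≤ ρ x) (hG : ∀ x, ρ x ≠ 0 → ContinuousAt G x) (hnull : ∀ᵐ x ∂μ, ρ x ≠ 0)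
    {C : ℝ} (hC : ∀ n, empiricalMean p (fun x => G x ^ 2) n ≤ C) :
    Integrable G μ ∧ Tendsto (empiricalMean p G) atTop (𝓝 (∫ x, G x ∂μ)) := by
  set χ : ℕ → X → ℝ := fun k x => cutoff k (ρ x) with hχ
  have hχc : ∀ k, Continuous (χ k) := fun k => (continuous_cutoff k).comp hρ
  have hχ0 : ∀ k x, 0 ≤ χ k x := fun k x => cutoff_nonneg _ _
  have hχ1 : ∀ k x, χ k x ≤ 1 := fun k x => cutoff_le_one _ _
  have hGc : ∀ k, Continuous (fun x => χ k x * G x) := continuous_cutoff_mul hρ hG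
  have hGc2 : ∀ k, Continuous (fun x => (χ k x * G x) ^ 2) := fun k => (hGc k).pow 2
  have hχc' : ∀ k, Continuous (fun x => 1 - χ k x) := fun k => continuous_const.sub (hχc k)
  have hχt : ∀ᵐ x ∂μ, Tendsto (fun k => χ k x) atTop (𝓝 1) := by
    filter_upwards [hnull] with x hx using tendsto_cutoff (lt_of_le_of_ne (hρ0 x) hx.symm)
  have hGt : ∀ᵐ x ∂μ, Tendsto (fun k => χ k x * G x) atTop (𝓝 (G x)) := by
    filter_upwards [hχt] with x hx using by simpa using hx.mul_const (G x)
  have hGm : AEStronglyMeasurable G μ :=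
    aestronglyMeasurable_of_tendsto_ae atTop
      (fun k => (hGc k).integrable_of_compactSpace.aestronglyMeasurable) hGt
  have hle : ∀ k x, (χ k x * G x) ^ 2 ≤ G x ^ 2 := fun k x => by
    rw [mul_pow]
    exact mul_le_of_le_one_left (sq_nonneg _) (pow_le_one₀ (hχ0 k x) (hχ1 k x))
  -- The truncated second moments are limits of orbit means, hence at most `C`; Fatou's lemma then
  -- passes the bound to `G` itself.
  have hsq : ∀ k, ∫ x, (χ k x * G x) ^ 2 ∂μ ≤ C := fun k =>
    le_of_tendsto' (hp _ (hGc2 k)) fun n => (empiricalMean_mono p (hle k) n).trans (hC n)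
  have hGsq : Integrable (fun x => G x ^ 2) μ := by
    refine ⟨hGm.pow 2, ?_⟩
    rw [hasFiniteIntegral_iff_ofReal (ae_of_all _ fun x => sq_nonneg _)]
    calc ∫⁻ x, ENNReal.ofReal (G x ^ 2) ∂μ
        = ∫⁻ x, liminf (fun k => ENNReal.ofReal ((χ k x * G x) ^ 2)) atTop ∂μ := by
          refine lintegral_congr_ae ?_
          filter_upwards [hGt] with x hx
          exact ((ENNReal.continuous_ofReal.tendsto _).comp (hx.pow 2)).liminf_eq.symm
      _ ≤ liminf (fun k => ∫⁻ x, ENNReal.ofReal ((χ k x * G x) ^ 2) ∂μ) atTop :=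
          lintegral_liminf_le fun k =>
            (ENNReal.continuous_ofReal.comp (hGc2 k)).measurable
      _ ≤ ENNReal.ofReal C := by
          refine liminf_le_of_le (by isBoundedDefault) fun b hb => ?_
          obtain ⟨k, hk⟩ := hb.exists
          refine hk.trans ?_
          rw [← ofReal_integral_eq_lintegral_ofReal
            (hGc2 k).integrable_of_compactSpace (ae_of_all _ fun x => sq_nonneg _)]
          exact ENNReal.ofReal_le_ofReal (hsq k)
      _ < ⊤ := ENNReal.ofReal_lt_top
  have hGi : Integrable G μ := ((memLp_two_iff_integrable_sq hGm).2 hGsq).integrable (by norm_num)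
  refine ⟨hGi, ?_⟩
  have hI : Tendsto (fun k => ∫ x, χ k x * G x ∂μ) atTop (𝓝 (∫ x, G x ∂μ)) := by
    refine tendsto_integral_of_dominated_convergence (fun x => ‖G x‖)
      (fun k => (hGc k).integrable_of_compactSpace.aestronglyMeasurable) hGi.norm
      (fun k => ae_of_all _ fun x => ?_) hGt
    rw [norm_mul, Real.norm_of_nonneg (hχ0 k x)]
    exact mul_le_of_le_one_left (norm_nonneg _) (hχ1 k x)
  have hJ : Tendsto (fun k => ∫ x, (1 - χ k x) ∂μ) atTop (𝓝 0) := by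
    have := tendsto_integral_of_dominated_convergence (μ := μ) (F := fun k x => 1 - χ k x)
      (f := fun _ => (0 : ℝ)) (fun _ => 1)
      (fun k => (hχc' k).integrable_of_compactSpace.aestronglyMeasurable)
      (integrable_const _) (fun k => ae_of_all _ fun x => ?_) ?_
    · simpa using this
    · rw [Real.norm_of_nonneg (by linarith [hχ1 k x])]
      linarith [hχ0 k x]
    · filter_upwards [hχt] with x hx using by simpa using hx.const_sub 1
  -- The mean of length `0` is `0`, since `1 / 0 = 0`.
  have hC0 : 0 ≤ C := by simpa [empiricalMean] using hC 0
  -- Weighted AM-GM splits the error into a second moment, small with `η`, and the mean of the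
  -- continuous function `1 - χ k`. The order of choice is `η`, then `k`, then `n`.
  have key : ∀ η : ℝ, 0 < η → ∀ k n,
      |empiricalMean p G n - empiricalMean p (fun x => χ k x * G x) n|
        ≤ η * C + η⁻¹ * empiricalMean p (fun x => 1 - χ k x) n := by
    intro η hη k n
    rw [← empiricalMean_sub]
    refine (abs_empiricalMean_le _ _ _).trans ?_
    calc empiricalMean p (fun x => |G x - χ k x * G x|) n
        ≤ empiricalMean p (fun x => η * G x ^ 2 + η⁻¹ * (1 - χ k x)) n := by
          refine empiricalMean_mono p (fun x => ?_) n
          have h1 : |G x - χ k x * G x| = |G x| * (1 - χ k x) := by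
            rw [← one_sub_mul, abs_mul, abs_of_nonneg (by linarith [hχ1 k x]), mul_comm]
          have h2 : (1 - χ k x) ^ 2 ≤ 1 - χ k x := by nlinarith [hχ0 k x, hχ1 k x]
          have h3 : |G x| * (1 - χ k x) ≤ η * |G x| ^ 2 + η⁻¹ * (1 - χ k x) ^ 2 := by
            have h4 : η⁻¹ * (η * |G x| - (1 - χ k x)) ^ 2
                = η * |G x| ^ 2 + η⁻¹ * (1 - χ k x) ^ 2 - 2 * (|G x| * (1 - χ k x)) := by
              field_simp
              ring
            have h5 : 0 ≤ η⁻¹ * (η * |G x| - (1 - χ k x)) ^ 2 := by positivity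
            have h6 : 0 ≤ |G x| * (1 - χ k x) :=
              mul_nonneg (abs_nonneg _) (by linarith [hχ1 k x])
            linarith
          rw [h1]
          rw [sq_abs] at h3
          linarith [mul_le_mul_of_nonneg_left h2 (inv_pos.2 hη).le]
      _ = η * empiricalMean p (fun x => G x ^ 2) n
          + η⁻¹ * empiricalMean p (fun x => 1 - χ k x) n := by
          rw [empiricalMean_add, empiricalMean_const_mul, empiricalMean_const_mul]
      _ ≤ _ := by gcongr; exact hC n
  rw [Metric.tendsto_atTop']
  intro ε hε
  set η : ℝ := ε / (4 * (C + 1)) with hηd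
  have hη : 0 < η := by positivity
  have hηC : η * C ≤ ε / 4 := by
    rw [hηd, div_mul_eq_mul_div, div_le_div_iff₀ (by positivity) (by norm_num)]
    nlinarith
  have hJ' : Tendsto (fun k => η⁻¹ * ∫ x, (1 - χ k x) ∂μ) atTop (𝓝 0) := by
    simpa using hJ.const_mul η⁻¹
  obtain ⟨k, hk1, hk2⟩ := ((hJ'.eventually_lt_const (by positivity : 0 < ε / 4)).and
    (Metric.tendsto_nhds.1 hI (ε / 4) (by positivity))).exists
  have e1 := ((hp _ (hχc' k)).const_mul η⁻¹).eventually_lt_const hk1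
  have e2 := Metric.tendsto_nhds.1 (hp _ (hGc k)) (ε / 4) (by positivity)
  obtain ⟨N, hN⟩ := (e1.and e2).exists_forall_of_atTop
  refine ⟨N, fun n hn => ?_⟩
  obtain ⟨h1, h2⟩ := hN n hn.le
  have h3 := key η hη k n
  rw [Real.dist_eq] at *
  rw [abs_lt] at *
  rw [abs_le] at h3
  constructor <;> linarith [h3.1, h3.2, h2.1, h2.2, hk2.1, hk2.2]

end Equidistribution

/-! ### Weyl's criterion on the two-dimensional torus -/

section TorusEquidistribution

noncomputable instance : MeasurableSpace Circle := borel Circle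

instance : BorelSpace Circle := ⟨rfl⟩

theorem continuous_circle_coe : Continuous (fun z : Circle => (z : ℂ)) := by fun_prop

/-- The covering of the torus by the plane. -/
noncomputable def torusExp (p : ℝ × ℝ) : Circle × Circle := (unitExp p.1, unitExp p.2)

theorem continuous_unitExp : Continuous unitExp :=
  Circle.exp.continuous.comp (continuous_const.mul continuous_id)

theorem continuous_torusExp : Continuous torusExp :=
  (continuous_unitExp.comp continuous_fst).prodMk (continuous_unitExp.comp continuous_snd)

/-- The image of Lebesgue measure on the unit square under the covering of the torus. -/
noncomputable def torusMeasure : Measure (Circle × Circle) :=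
  (volume.restrict unitSquare).map torusExp

theorem volume_restrict_unitSquare : (volume : Measure (ℝ × ℝ)).restrict unitSquare =
    (volume.restrict (Set.Icc (0 : ℝ) 1)).prod (volume.restrict (Set.Icc (0 : ℝ) 1)) := by
  rw [unitSquare, Measure.volume_eq_prod, Measure.prod_restrict]

instance : IsProbabilityMeasure torusMeasure := by
  have : IsProbabilityMeasure ((volume : Measure (ℝ × ℝ)).restrict unitSquare) := by
    constructor
    rw [volume_restrict_unitSquare, ← Set.univ_prod_univ, Measure.prod_prod]
    simp
  exact Measure.isProbabilityMeasure_map continuous_torusExp.measurable.aemeasurable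

theorem coe_unitExp_zpow (t : ℝ) (a : ℤ) :
    ((unitExp t ^ a : Circle) : ℂ) = Complex.exp ((2 * Real.pi * a * Complex.I) * t) := by
  rw [Circle.coe_zpow, unitExp, Circle.coe_exp, ← Complex.exp_int_mul]
  congr 1
  push_cast
  ring

theorem integral_unitExp_zpow {a : ℤ} (ha : a ≠ 0) :
    ∫ t in Set.Icc (0 : ℝ) 1, ((unitExp t ^ a : Circle) : ℂ) = 0 := by
  have hc : (2 * Real.pi * a * Complex.I : ℂ) ≠ 0 := by
    simp [Real.pi_ne_zero, ha]
  simp only [coe_unitExp_zpow]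
  rw [integral_Icc_eq_integral_Ioc, ← intervalIntegral.integral_of_le zero_le_one,
    integral_exp_mul_complex hc]
  have : Complex.exp (2 * Real.pi * a * Complex.I) = 1 := by
    rw [← Complex.exp_int_mul_two_pi_mul_I a]
    congr 1
    ring
  simp [this]

/-- The characters of the torus, as a homomorphism into its continuous functions. -/
noncomputable def torusChar : Multiplicative (ℤ × ℤ) →* C(Circle × Circle, ℂ) where
  toFun q := ⟨fun z => ((z.1 ^ (q.toAdd.1) * z.2 ^ (q.toAdd.2) : Circle) : ℂ),
    continuous_circle_coe.comp ((continuous_fst.zpow _).mul (continuous_snd.zpow _))⟩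
  map_one' := by ext; simp
  map_mul' q r := by
    ext z
    simp only [ContinuousMap.coe_mk, ContinuousMap.mul_apply, ← Circle.coe_mul, toAdd_mul,
      Prod.fst_add, Prod.snd_add, zpow_add]
    congr 1
    exact mul_mul_mul_comm _ _ _ _

theorem torusChar_apply (q : Multiplicative (ℤ × ℤ)) (z : Circle × Circle) :
    torusChar q z = ((z.1 ^ (q.toAdd.1) * z.2 ^ (q.toAdd.2) : Circle) : ℂ) := rfl

theorem star_torusChar (q : Multiplicative (ℤ × ℤ)) : star (torusChar q) = torusChar q⁻¹ := by
  ext z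
  rw [ContinuousMap.star_apply, torusChar_apply, torusChar_apply, Complex.star_def,
    ← Circle.coe_inv_eq_conj]
  simp [mul_comm]

theorem integral_torusChar {q : Multiplicative (ℤ × ℤ)} (hq : q ≠ 1) :
    ∫ z, torusChar q z ∂torusMeasure = 0 := by
  rw [torusMeasure, integral_map continuous_torusExp.measurable.aemeasurable
    (torusChar q).continuous.aestronglyMeasurable, volume_restrict_unitSquare]
  simp only [torusChar_apply, torusExp, Circle.coe_mul]
  rw [integral_prod_mul (fun t => ((unitExp t ^ (q.toAdd.1) : Circle) : ℂ))
    (fun t => ((unitExp t ^ (q.toAdd.2) : Circle) : ℂ))]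
  by_cases h1 : q.toAdd.1 = 0
  · have h2 : q.toAdd.2 ≠ 0 := fun h2 => hq (Multiplicative.toAdd.injective (Prod.ext h1 h2))
    rw [integral_unitExp_zpow h2, mul_zero]
  · rw [integral_unitExp_zpow h1, zero_mul]

/-- Stone–Weierstrass: the characters are closed under products and conjugation, so their span is
already a star subalgebra, and the two coordinates separate points. -/
theorem span_torusChar_topologicalClosure :
    (Submodule.span ℂ (Set.range torusChar)).topologicalClosure = ⊤ := by
  set A := StarAlgebra.adjoin ℂ (Set.range torusChar) with hA
  have hstar : star (Set.range torusChar) ⊆ Set.range torusChar := by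
    rintro f ⟨q, hq⟩
    refine ⟨q⁻¹, ?_⟩
    rw [← star_torusChar, hq, star_star]
  have hspan : Subalgebra.toSubmodule A.toSubalgebra = Submodule.span ℂ (Set.range torusChar) := by
    rw [hA, StarAlgebra.adjoin_toSubalgebra, Set.union_eq_self_of_subset_right hstar,
      Algebra.adjoin_eq_span, ← MonoidHom.coe_mrange, Submonoid.closure_eq]
  have hsep : A.SeparatesPoints := by
    intro x y hxy
    have hmem : ∀ q, torusChar q ∈ A := fun q =>
      StarAlgebra.subset_adjoin ℂ _ (Set.mem_range_self q)
    by_cases h1 : x.1 = y.1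
    · refine ⟨_, ⟨_, hmem (Multiplicative.ofAdd (0, 1)), rfl⟩, ?_⟩
      have h2 : x.2 ≠ y.2 := fun h2 => hxy (Prod.ext h1 h2)
      simpa [torusChar_apply, Circle.ext_iff] using h2
    · refine ⟨_, ⟨_, hmem (Multiplicative.ofAdd (1, 0)), rfl⟩, ?_⟩
      simpa [torusChar_apply, Circle.ext_iff] using h1
  have htop := ContinuousMap.starSubalgebra_topologicalClosure_eq_top_of_separatesPoints A hsep
  rw [← hspan, eq_top_iff]
  intro f _
  have : f ∈ A.topologicalClosure := htop ▸ StarSubalgebra.mem_top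
  exact this

/-- The complex mean value along a sequence. -/
noncomputable def complexMean {X : Type*} (p : ℕ → X) (g : X → ℂ) (n : ℕ) : ℂ :=
  (1 / (n : ℂ)) * ∑ m ∈ Finset.Icc 1 n, g (p m)

theorem norm_complexMean_le {X : Type*} (p : ℕ → X) {g : X → ℂ} {ε : ℝ} (hε : 0 ≤ ε)
    (hg : ∀ x, ‖g x‖ ≤ ε) (n : ℕ) : ‖complexMean p g n‖ ≤ ε := by
  rcases Nat.eq_zero_or_pos n with rfl | hn
  · simpa [complexMean] using hε
  · have hn' : (0 : ℝ) < n := by exact_mod_cast hn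
    rw [complexMean, norm_mul, norm_div, norm_one, Complex.norm_natCast, one_div_mul_eq_div,
      div_le_iff₀ hn']
    calc ‖∑ m ∈ Finset.Icc 1 n, g (p m)‖ ≤ ∑ m ∈ Finset.Icc 1 n, ε :=
          norm_sum_le_of_le _ fun m _ => hg _
      _ = ε * n := by simp [mul_comm]

/-- Weyl's criterion on the two-dimensional torus. -/
theorem isEquidistributed_torusMeasure {p : ℕ → Circle × Circle}
    (hp : ∀ q : Multiplicative (ℤ × ℤ), q ≠ 1 →
      Tendsto (complexMean p (torusChar q)) atTop (𝓝 0)) :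
    IsEquidistributed p torusMeasure := by
  have hint : ∀ f : C(Circle × Circle, ℂ), Integrable f torusMeasure := fun f =>
    f.continuous.integrable_of_hasCompactSupport (HasCompactSupport.of_compactSpace f)
  have hspan : ∀ f ∈ Submodule.span ℂ (Set.range torusChar),
      Tendsto (complexMean p f) atTop (𝓝 (∫ z, f z ∂torusMeasure)) := by
    intro f hf
    induction hf using Submodule.span_induction with
    | mem f hf =>
      obtain ⟨q, rfl⟩ := hf
      by_cases hq : q = 1
      · subst hq
        simp only [map_one, ContinuousMap.one_apply, integral_const, probReal_univ, one_smul]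
        refine tendsto_const_nhds.congr' ?_
        filter_upwards [eventually_gt_atTop 0] with n hn
        have : (n : ℂ) ≠ 0 := by exact_mod_cast hn.ne'
        simp [complexMean, this]
      · rw [integral_torusChar hq]
        exact hp q hq
    | zero =>
      have h0 : complexMean p ⇑(0 : C(Circle × Circle, ℂ)) = fun _ => 0 := by
        funext n
        simp [complexMean]
      have h1 : ∫ z, (0 : C(Circle × Circle, ℂ)) z ∂torusMeasure = 0 := by simp
      rw [h0, h1]
      exact tendsto_const_nhds
    | add f g _ _ hf hg =>
      simp only [ContinuousMap.add_apply]
      rw [integral_add (hint f) (hint g)]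
      refine (hf.add hg).congr fun n => ?_
      simp [complexMean, Finset.sum_add_distrib, mul_add]
    | smul c f _ hf =>
      rw [show ∫ z, (c • f) z ∂torusMeasure = c • ∫ z, f z ∂torusMeasure from integral_smul c _]
      refine (hf.const_smul c).congr fun n => ?_
      simp only [complexMean, ContinuousMap.smul_apply, smul_eq_mul, ← Finset.mul_sum]
      ring
  have hall : ∀ f : C(Circle × Circle, ℂ),
      Tendsto (complexMean p f) atTop (𝓝 (∫ z, f z ∂torusMeasure)) := by
    intro f
    rw [Metric.tendsto_atTop]
    intro ε hε
    have hf : f ∈ (Submodule.span ℂ (Set.range torusChar)).topologicalClosure := by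
      rw [span_torusChar_topologicalClosure]; trivial
    obtain ⟨g, hg, hfg⟩ := Metric.mem_closure_iff.1 hf (ε / 3) (by positivity)
    obtain ⟨N, hN⟩ := Metric.tendsto_atTop.1 (hspan g hg) (ε / 3) (by positivity)
    have hb : ∀ z, ‖f z - g z‖ ≤ ε / 3 := fun z => by
      rw [← dist_eq_norm]
      exact (ContinuousMap.dist_apply_le_dist z).trans hfg.le
    refine ⟨N, fun n hn => ?_⟩
    have h1 : dist (complexMean p f n) (complexMean p g n) ≤ ε / 3 := by
      have h0 : complexMean p f n - complexMean p g n = complexMean p (fun z => f z - g z) n := by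
        simp only [complexMean, Finset.sum_sub_distrib, mul_sub]
      rw [dist_eq_norm, h0]
      exact norm_complexMean_le p (by positivity) hb n
    have h2 : dist (∫ z, g z ∂torusMeasure) (∫ z, f z ∂torusMeasure) ≤ ε / 3 := by
      rw [dist_comm, dist_eq_norm, ← integral_sub (hint f) (hint g)]
      simpa using norm_integral_le_of_norm_le_const (μ := torusMeasure) (ae_of_all _ hb)
    linarith [dist_triangle4 (complexMean p f n) (complexMean p g n) (∫ z, g z ∂torusMeasure)
      (∫ z, f z ∂torusMeasure), hN n hn]
  intro h hh
  have h1 : Tendsto (complexMean p fun z => (h z : ℂ)) atTop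
      (𝓝 ((∫ z, h z ∂torusMeasure : ℝ) : ℂ)) := by
    rw [← integral_complex_ofReal]
    exact hall ⟨fun z => (h z : ℂ), by fun_prop⟩
  refine ((Complex.continuous_re.tendsto _).comp h1).congr fun n => ?_
  have : complexMean p (fun z => (h z : ℂ)) n = ((empiricalMean p h n : ℝ) : ℂ) := by
    simp [complexMean, empiricalMean]
  rw [Function.comp_apply, this, Complex.ofReal_re]

/-- A sequence of powers `(x ^ m, y ^ m)` is equidistributed on the torus if `x` and `y` are
multiplicatively independent. -/
theorem isEquidistributed_pow {x y : Circle}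
    (hxy : ∀ a b : ℤ, (a, b) ≠ 0 → x ^ a * y ^ b ≠ 1) :
    IsEquidistributed (fun m => (x ^ m, y ^ m)) torusMeasure := by
  refine isEquidistributed_torusMeasure fun q hq => ?_
  set w : Circle := x ^ q.toAdd.1 * y ^ q.toAdd.2 with hw
  have hw1 : (w : ℂ) ≠ 1 := fun h => hxy q.toAdd.1 q.toAdd.2
    (fun h0 => hq (Multiplicative.toAdd.injective h0)) (Circle.coe_eq_one.1 h)
  have hpow : ∀ m : ℕ, torusChar q (x ^ m, y ^ m) = (w : ℂ) ^ m := fun m => by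
    rw [torusChar_apply, ← Circle.coe_pow, hw, mul_pow, ← zpow_natCast, ← zpow_natCast,
      ← zpow_natCast, ← zpow_natCast, ← zpow_mul, ← zpow_mul, ← zpow_mul, ← zpow_mul,
      mul_comm (m : ℤ), mul_comm (m : ℤ)]
  have hd : 0 < ‖(w : ℂ) - 1‖ := norm_pos_iff.2 (sub_ne_zero.2 hw1)
  -- Partial geometric sums with unimodular ratio `w ≠ 1` are bounded, so their means tend to `0`.
  have hbound : ∀ n : ℕ, ‖∑ m ∈ Finset.Icc 1 n, (w : ℂ) ^ m‖ ≤ 2 / ‖(w : ℂ) - 1‖ := fun n => by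
    have : ∑ m ∈ Finset.Icc 1 n, (w : ℂ) ^ m = w * ((w ^ n - 1) / (w - 1)) := by
      rw [← geom_sum_eq hw1, Finset.mul_sum, Finset.range_eq_Ico,
        Finset.sum_Ico_eq_sum_range, ← Finset.Ico_add_one_right_eq_Icc,
        Finset.sum_Ico_eq_sum_range]
      simp [pow_add]
    rw [this, norm_mul, norm_div, Circle.norm_coe, one_mul]
    gcongr
    refine (norm_sub_le _ _).trans ?_
    rw [norm_pow, Circle.norm_coe]
    norm_num
  rw [tendsto_zero_iff_norm_tendsto_zero]
  refine squeeze_zero (fun n => norm_nonneg _) (fun n => ?_)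
    (tendsto_const_div_atTop_nhds_zero_nat (2 / ‖(w : ℂ) - 1‖))
  simp only [complexMean, hpow]
  rw [norm_mul, norm_div, norm_one, Complex.norm_natCast, one_div_mul_eq_div]
  gcongr
  exact hbound n

end TorusEquidistribution

/-! ### Fourth moments and growth of logarithmic singularities along an orbit -/

section LogMoments

/-- Repeatedly removing an index whose value is at most `B` of the current cardinality replaces a
sorting of the values. -/
theorem sum_le_sum_of_forall_subset_exists_le {w B : ℕ → ℝ} (T : Finset ℕ)
    (h : ∀ S ⊆ T, S.Nonempty → ∃ m ∈ S, w m ≤ B S.card) :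
    ∑ m ∈ T, w m ≤ ∑ j ∈ Finset.Icc 1 T.card, B j := by
  induction T using Finset.strongInduction with
  | H T ih =>
    rcases T.eq_empty_or_nonempty with rfl | hT
    · simp
    · obtain ⟨m, hm, hw⟩ := h T subset_rfl hT
      have h1 := ih (T.erase m) (Finset.erase_ssubset hm)
        fun S hS => h S (hS.trans (Finset.erase_subset _ _))
      have h2 : (T.erase m).card + 1 = T.card := Finset.card_erase_add_one hm
      rw [← Finset.sum_erase_add _ _ hm, ← h2, Finset.sum_Icc_succ_top (by omega), h2]
      linarith

/-- Pigeonhole: the range up to `n` is cut into `S.card - 1` boxes of length `n / (S.card - 1)`, and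
two elements of `S` share a box. -/
theorem exists_lt_sub_mul_le {n : ℕ} {S : Finset ℕ} (hS : S ⊆ Finset.Icc 1 n)
    (hcard : 2 ≤ S.card) : ∃ a ∈ S, ∃ b ∈ S, a < b ∧ (b - a) * (S.card - 1) ≤ n := by
  have hn : 0 < n := by
    obtain ⟨a, ha⟩ := Finset.card_pos.1 (by omega : 0 < S.card)
    have := Finset.mem_Icc.1 (hS ha)
    omega
  obtain ⟨a, ha, b, hb, hab, hf⟩ := Finset.exists_ne_map_eq_of_card_lt_of_maps_to
    (s := S) (t := Finset.range (S.card - 1)) (f := fun m => (m - 1) * (S.card - 1) / n)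
    (by rw [Finset.card_range]; omega) (fun m hm => by
      have := Finset.mem_Icc.1 (hS hm)
      simp only [Finset.coe_range, Set.mem_Iio]
      rw [Nat.div_lt_iff_lt_mul hn, mul_comm (S.card - 1) n]
      exact Nat.mul_lt_mul_of_pos_right (by omega) (by omega))
  wlog hlt : a < b generalizing a b
  · exact this b hb a ha hab.symm hf.symm (by omega)
  refine ⟨a, ha, b, hb, hlt, ?_⟩
  have ha1 := Finset.mem_Icc.1 (hS ha)
  have h1 := Nat.div_add_mod ((a - 1) * (S.card - 1)) n
  have h2 := Nat.div_add_mod ((b - 1) * (S.card - 1)) n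
  have h3 := Nat.mod_lt ((b - 1) * (S.card - 1)) hn
  rw [hf] at h1
  have h4 : (b - 1) * (S.card - 1) = (b - a) * (S.card - 1) + (a - 1) * (S.card - 1) := by
    rw [← add_mul]
    congr 1
    omega
  omega

/-- The powers of `x` approach `1` at most polynomially fast. -/
def IsDiophantine (x : Circle) : Prop :=
  ∃ K : ℝ, ∃ γ : ℕ, 0 < K ∧ ∀ n : ℕ, 1 ≤ n → K / (n : ℝ) ^ γ ≤ ‖(x : ℂ) ^ n - 1‖

theorem Circle.norm_pow_sub_one_le (z : Circle) (k : ℕ) :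
    ‖(z : ℂ) ^ k - 1‖ ≤ k * ‖(z : ℂ) - 1‖ := by
  rw [← geom_sum_mul, norm_mul]
  gcongr
  calc ‖∑ i ∈ Finset.range k, (z : ℂ) ^ i‖ ≤ ∑ i ∈ Finset.range k, (1 : ℝ) :=
        norm_sum_le_of_le _ fun i _ => by
          rw [norm_pow, Circle.norm_coe, one_pow]
    _ = k := by simp

theorem Circle.norm_sub_le_two (z w : Circle) : ‖(z : ℂ) - w‖ ≤ 2 := by
  refine (norm_sub_le _ _).trans ?_
  simp only [Circle.norm_coe]
  norm_num

/-- If two close indices `u < v` both brought `x ^ m` near `a`, then `x ^ (v - u)` would be near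
`1`. For a single index, taking `k`-th powers removes `a` and compares with `x ^ (m * k)`. -/
theorem IsDiophantine.exists_le_norm_pow_sub {x a : Circle} (hx : IsDiophantine x) {k : ℕ}
    (hk : 0 < k) (ha : a ^ k = 1) :
    ∃ c : ℝ, ∃ γ : ℕ, 0 < c ∧ c ≤ 1 ∧ ∀ (n : ℕ) (S : Finset ℕ), S ⊆ Finset.Icc 1 n → S.Nonempty →
      ∃ m ∈ S, c * ((S.card : ℝ) / n) ^ γ ≤ ‖((x ^ m : Circle) : ℂ) - a‖ := by
  obtain ⟨K, γ, hK, hx⟩ := hx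
  have hk' : (0 : ℝ) < k := by exact_mod_cast hk
  -- The second entry serves a single index: one factor `k` is lost in taking the `k`-th power, and
  -- `k ^ γ` comes from the exponent `m * k`. The third serves pairs: `2` from the triangle
  -- inequality, `2 ^ γ` from `S.card ≤ 2 * (S.card - 1)`.
  set c : ℝ := min 1 (min (K / (k * (k : ℝ) ^ γ)) (K / (2 * 2 ^ γ))) with hc
  have hc1 : c ≤ K / (k * (k : ℝ) ^ γ) := (min_le_right _ _).trans (min_le_left _ _)
  have hc2 : c ≤ K / (2 * 2 ^ γ) := (min_le_right _ _).trans (min_le_right _ _)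
  refine ⟨c, γ, by positivity, min_le_left _ _, fun n S hS hne => ?_⟩
  have hn : (0 : ℝ) < n := by
    obtain ⟨m, hm⟩ := hne
    have := Finset.mem_Icc.1 (hS hm)
    exact_mod_cast (by omega : 0 < n)
  rcases Nat.lt_or_ge S.card 2 with h2 | h2
  · have h1 : S.card = 1 := by have := hne.card_pos; omega
    obtain ⟨m, hm⟩ := hne
    refine ⟨m, hm, ?_⟩
    have hmI := Finset.mem_Icc.1 (hS hm)
    have hm0 : (0 : ℝ) < m := by exact_mod_cast (by omega : 0 < m)
    have hmn : (m : ℝ) ≤ n := by exact_mod_cast hmI.2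
    have e1 : ‖((x ^ m * a⁻¹ : Circle) : ℂ) - 1‖ = ‖((x ^ m : Circle) : ℂ) - a‖ := by
      have : ((x ^ m * a⁻¹ : Circle) : ℂ) - 1 = (((x ^ m : Circle) : ℂ) - a) * (a⁻¹ : Circle) := by
        rw [sub_mul, ← Circle.coe_mul, ← Circle.coe_mul, mul_inv_cancel, Circle.coe_one]
      rw [this, norm_mul, Circle.norm_coe, mul_one]
    have e2 := Circle.norm_pow_sub_one_le (x ^ m * a⁻¹) k
    have e3 : (((x ^ m * a⁻¹ : Circle) : ℂ)) ^ k = (x : ℂ) ^ (m * k) := by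
      rw [← Circle.coe_pow, ← Circle.coe_pow, mul_pow, inv_pow, ha, inv_one, mul_one, pow_mul]
    rw [e1, e3] at e2
    have e4 := hx (m * k) (Nat.mul_pos (by omega) hk)
    rw [h1, Nat.cast_one]
    calc c * (1 / (n : ℝ)) ^ γ ≤ K / (k * (k : ℝ) ^ γ) * (1 / (m : ℝ)) ^ γ := by gcongr
      _ = K / ((m * k : ℕ) : ℝ) ^ γ / k := by
        rw [one_div_pow]; push_cast; rw [mul_pow]; field_simp
      _ ≤ _ := by rw [div_le_iff₀ hk']; linarith
  · obtain ⟨u, hu, v, hv, huv, hgap⟩ := exists_lt_sub_mul_le hS h2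
    set d := v - u with hd
    have hd0 : (0 : ℝ) < d := by exact_mod_cast (by omega : 0 < d)
    have e1 := hx d (by omega)
    have hdn : (S.card : ℝ) / n ≤ 2 / d := by
      rw [div_le_div_iff₀ hn hd0]
      have : S.card * d ≤ 2 * n := by
        calc S.card * d ≤ (2 * (S.card - 1)) * d := Nat.mul_le_mul_right _ (by omega)
          _ = 2 * (d * (S.card - 1)) := by ring
          _ ≤ 2 * n := Nat.mul_le_mul_left _ hgap
      exact_mod_cast this
    have e2 : ‖(x : ℂ) ^ d - 1‖ ≤ ‖((x ^ u : Circle) : ℂ) - a‖ + ‖((x ^ v : Circle) : ℂ) - a‖ := by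
      have : ((x ^ v : Circle) : ℂ) - a - (((x ^ u : Circle) : ℂ) - a)
          = (x : ℂ) ^ u * ((x : ℂ) ^ d - 1) := by
        rw [mul_sub, ← pow_add, hd, Nat.add_sub_cancel' huv.le, Circle.coe_pow, Circle.coe_pow]
        ring
      have h3 := norm_sub_le (((x ^ v : Circle) : ℂ) - a) (((x ^ u : Circle) : ℂ) - a)
      rw [this, norm_mul, norm_pow, Circle.norm_coe, one_pow, one_mul] at h3
      linarith
    have e3 : c * ((S.card : ℝ) / n) ^ γ ≤ K / (d : ℝ) ^ γ / 2 := by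
      calc c * ((S.card : ℝ) / n) ^ γ ≤ K / (2 * 2 ^ γ) * (2 / (d : ℝ)) ^ γ := by gcongr
        _ = K / (d : ℝ) ^ γ / 2 := by rw [div_pow]; field_simp
    rcases le_total ‖((x ^ u : Circle) : ℂ) - a‖ ‖((x ^ v : Circle) : ℂ) - a‖ with h | h
    · exact ⟨v, hv, by linarith⟩
    · exact ⟨u, hu, by linarith⟩

theorem sum_sqrt_div_le (n : ℕ) : ∑ j ∈ Finset.Icc 1 n, √((n : ℝ) / j) ≤ 2 * n := by
  have key : ∀ N : ℕ, ∑ j ∈ Finset.Icc 1 N, 1 / √(j : ℝ) ≤ 2 * √(N : ℝ) := by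
    intro N
    induction N with
    | zero => simp
    | succ N ih =>
      rw [Finset.sum_Icc_succ_top (by omega)]
      have h0 : 0 < √((N + 1 : ℕ) : ℝ) := Real.sqrt_pos.2 (by positivity)
      have h1 : √((N + 1 : ℕ) : ℝ) ^ 2 = N + 1 := by rw [Real.sq_sqrt (by positivity)]; simp
      have h2 : √(N : ℝ) ^ 2 = N := Real.sq_sqrt (by positivity)
      have h3 : 1 / √((N + 1 : ℕ) : ℝ) ≤ 2 * √((N + 1 : ℕ) : ℝ) - 2 * √(N : ℝ) := by
        rw [div_le_iff₀ h0]
        nlinarith [sq_nonneg (√((N + 1 : ℕ) : ℝ) - √(N : ℝ))]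
      linarith
  calc ∑ j ∈ Finset.Icc 1 n, √((n : ℝ) / j) = √(n : ℝ) * ∑ j ∈ Finset.Icc 1 n, 1 / √(j : ℝ) := by
        rw [Finset.mul_sum]
        refine Finset.sum_congr rfl fun j _ => ?_
        rw [Real.sqrt_div (by positivity), mul_one_div]
    _ ≤ √(n : ℝ) * (2 * √(n : ℝ)) := by gcongr; exact key n
    _ = 2 * (√(n : ℝ) * √(n : ℝ)) := by ring
    _ = 2 * n := by rw [Real.mul_self_sqrt (by positivity)]

theorem abs_log_le_of_le_of_le_two {c d s : ℝ} {γ : ℕ} (hc : 0 < c) (hc1 : c ≤ 1) (hs : 0 < s)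
    (hs1 : s ≤ 1) (hd : c * s ^ γ ≤ d) (hd2 : d ≤ 2) :
    |Real.log d| ≤ 1 + |Real.log c| + γ * Real.log s⁻¹ := by
  have h0 : 0 < c * s ^ γ := by positivity
  have h1 : Real.log (c * s ^ γ) ≤ Real.log d := Real.log_le_log h0 hd
  rw [Real.log_mul hc.ne' (by positivity), Real.log_pow] at h1
  have h2 : Real.log d ≤ 1 := by
    have := Real.log_le_sub_one_of_pos (h0.trans_le hd)
    linarith
  have h3 : 0 ≤ Real.log s⁻¹ := Real.log_nonneg ((one_le_inv₀ hs).2 hs1)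
  have h4 : 0 ≤ γ * Real.log s⁻¹ := by positivity
  rw [Real.log_inv] at *
  rw [abs_of_nonpos (Real.log_nonpos hc.le hc1), abs_le]
  constructor <;> linarith [Real.log_nonpos hc.le hc1]

/-- The fourth moments of `g` along the powers of `x` are bounded. -/
def HasBoundedFourthMoments (x : Circle) (g : Circle → ℝ) : Prop :=
  ∃ C : ℝ, ∀ n : ℕ, ∑ m ∈ Finset.Icc 1 n, g (x ^ m) ^ 4 ≤ C * n

theorem IsDiophantine.hasBoundedFourthMoments_log {x a : Circle} (hx : IsDiophantine x) {k : ℕ}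
    (hk : 0 < k) (ha : a ^ k = 1) :
    HasBoundedFourthMoments x (fun z => |Real.log ‖(z : ℂ) - a‖|) := by
  obtain ⟨c, γ, hc, hc1, hx⟩ := hx.exists_le_norm_pow_sub hk ha
  -- The `8` comes from `log t ≤ 8 * t ^ (1 / 8)`; the exponent `1 / 8` turns fourth powers into
  -- `√(n / j)`, whose sum over `j` is at most `2 * n`.
  set A : ℝ := 1 + |Real.log c| + 8 * γ with hA
  refine ⟨2 * A ^ 4, fun n => ?_⟩
  have key := sum_le_sum_of_forall_subset_exists_le
    (w := fun m => |Real.log ‖((x ^ m : Circle) : ℂ) - a‖| ^ 4)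
    (B := fun j => A ^ 4 * √((n : ℝ) / j)) (Finset.Icc 1 n) fun S hS hne => by
      obtain ⟨m, hm, hle⟩ := hx n S hS hne
      refine ⟨m, hm, ?_⟩
      have hj0 : 0 < S.card := hne.card_pos
      have hjn : S.card ≤ n := by simpa using Finset.card_le_card hS
      have hj : (0 : ℝ) < S.card := by exact_mod_cast hj0
      have hn : (0 : ℝ) < n := by exact_mod_cast hj0.trans_le hjn
      have hs1 : (S.card : ℝ) / n ≤ 1 := by rw [div_le_one hn]; exact_mod_cast hjn
      have h1 := abs_log_le_of_le_of_le_two hc hc1 (by positivity) hs1 hle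
        (Circle.norm_sub_le_two _ _)
      rw [inv_div] at h1
      set t : ℝ := (n : ℝ) / S.card with ht
      have ht1 : 1 ≤ t := by rw [ht, one_le_div hj]; exact_mod_cast hjn
      have h2 : Real.log t ≤ t ^ (1 / 8 : ℝ) / (1 / 8) :=
        Real.log_le_rpow_div (by positivity) (by norm_num)
      have h3 : 1 ≤ t ^ (1 / 8 : ℝ) := Real.one_le_rpow ht1 (by norm_num)
      have h4 : |Real.log ‖((x ^ m : Circle) : ℂ) - a‖| ≤ A * t ^ (1 / 8 : ℝ) := by
        have h5 : (γ : ℝ) * Real.log t ≤ γ * (t ^ (1 / 8 : ℝ) / (1 / 8)) := by gcongr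
        have h6 : (1 + |Real.log c|) * 1 ≤ (1 + |Real.log c|) * t ^ (1 / 8 : ℝ) := by gcongr
        rw [hA]
        linarith
      have h7 : (t ^ (1 / 8 : ℝ)) ^ 4 = √t := by
        rw [← Real.rpow_natCast, ← Real.rpow_mul (by positivity), Real.sqrt_eq_rpow]
        norm_num
      calc |Real.log ‖((x ^ m : Circle) : ℂ) - a‖| ^ 4 ≤ (A * t ^ (1 / 8 : ℝ)) ^ 4 := by gcongr
        _ = A ^ 4 * √t := by rw [mul_pow, h7]
  refine key.trans ?_
  rw [← Finset.mul_sum, Nat.card_Icc, Nat.add_sub_cancel]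
  calc A ^ 4 * ∑ j ∈ Finset.Icc 1 n, √((n : ℝ) / j) ≤ A ^ 4 * (2 * n) := by
        gcongr
        exact sum_sqrt_div_le n
    _ = _ := by ring

theorem IsDiophantine.isBigO_log_norm_pow_sub {x a : Circle} (hx : IsDiophantine x) {k : ℕ}
    (hk : 0 < k) (ha : a ^ k = 1) :
    (fun n : ℕ => |Real.log ‖((x ^ n : Circle) : ℂ) - a‖|) =O[atTop]
      (fun n : ℕ => Real.log (n : ℝ)) := by
  obtain ⟨c, γ, hc, hc1, hx⟩ := hx.exists_le_norm_pow_sub hk ha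
  refine Asymptotics.IsBigO.of_bound (1 + |Real.log c| + γ) ?_
  -- From `3 > e` on, `log n ≥ 1` absorbs the additive constants.
  filter_upwards [eventually_ge_atTop 3] with n hn
  have hn3 : (3 : ℝ) ≤ n := by exact_mod_cast hn
  obtain ⟨m, hm, hle⟩ := hx n {n} (by simp; omega) (by simp)
  obtain rfl : m = n := by simpa using hm
  have hlog : 1 ≤ Real.log m := by
    rw [Real.le_log_iff_exp_le (by linarith)]
    linarith [Real.exp_one_lt_d9]
  have h1 := abs_log_le_of_le_of_le_two hc hc1 (by positivity)
    (by simpa using inv_le_one_of_one_le₀ (by linarith)) hle (Circle.norm_sub_le_two _ _)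
  rw [Finset.card_singleton, Nat.cast_one, one_div, inv_inv] at h1
  rw [Real.norm_eq_abs, abs_abs, Real.norm_of_nonneg (by linarith)]
  nlinarith [mul_le_mul_of_nonneg_left hlog (by positivity : 0 ≤ 1 + |Real.log c|)]

theorem HasBoundedFourthMoments.mono {x : Circle} {g h : Circle → ℝ}
    (hh : HasBoundedFourthMoments x h) (hgh : ∀ z, |g z| ≤ h z) : HasBoundedFourthMoments x g := by
  obtain ⟨C, hC⟩ := hh
  refine ⟨C, fun n => (Finset.sum_le_sum fun m _ => ?_).trans (hC n)⟩
  rw [← (by decide : Even 4).pow_abs (g (x ^ m))]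
  exact pow_le_pow_left₀ (abs_nonneg _) (hgh _) 4

theorem HasBoundedFourthMoments.const (x : Circle) (c : ℝ) :
    HasBoundedFourthMoments x (fun _ => c) :=
  ⟨c ^ 4, fun n => by simp [mul_comm]⟩

theorem HasBoundedFourthMoments.add {x : Circle} {g h : Circle → ℝ}
    (hg : HasBoundedFourthMoments x g) (hh : HasBoundedFourthMoments x h) :
    HasBoundedFourthMoments x (fun z => g z + h z) := by
  obtain ⟨C, hC⟩ := hg
  obtain ⟨D, hD⟩ := hh
  refine ⟨8 * (C + D), fun n => ?_⟩
  calc ∑ m ∈ Finset.Icc 1 n, (g (x ^ m) + h (x ^ m)) ^ 4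
      ≤ ∑ m ∈ Finset.Icc 1 n, 8 * (g (x ^ m) ^ 4 + h (x ^ m) ^ 4) := by
        refine Finset.sum_le_sum fun m _ => ?_
        have := (by decide : Even 4).add_pow_le (a := g (x ^ m)) (b := h (x ^ m))
        norm_num at this
        exact this
    _ = 8 * (∑ m ∈ Finset.Icc 1 n, g (x ^ m) ^ 4 + ∑ m ∈ Finset.Icc 1 n, h (x ^ m) ^ 4) := by
        rw [← Finset.sum_add_distrib, Finset.mul_sum]
    _ ≤ 8 * (C + D) * n := by linarith [hC n, hD n]

end LogMoments

/-! ### The covering of the circle by the line -/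

section UnitExp

theorem map_unitExp_nhds (t : ℝ) : map unitExp (𝓝 t) = 𝓝 (unitExp t) := by
  have h : unitExp = Circle.exp ∘ Homeomorph.mulLeft₀ (2 * Real.pi) (by positivity) := rfl
  rw [h, ← Filter.map_map, Homeomorph.map_nhds_eq, isLocalHomeomorph_circleExp.map_nhds_eq]
  rfl

theorem continuousAt_of_comp_unitExp {Y : Type*} [TopologicalSpace Y] {g : Circle → Y} {t : ℝ}
    (h : ContinuousAt (fun s => g (unitExp s)) t) : ContinuousAt g (unitExp t) := by
  rw [ContinuousAt, ← map_unitExp_nhds, tendsto_map'_iff]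
  exact h

theorem unitExp_eq_one_iff {t : ℝ} : unitExp t = 1 ↔ ∃ n : ℤ, t = n := by
  rw [unitExp, ← Circle.exp_zero, Circle.exp_eq_exp]
  refine exists_congr fun n => ?_
  rw [zero_add, mul_comm (n : ℝ), mul_right_inj' (by positivity)]

theorem unitExp_add (s t : ℝ) : unitExp (s + t) = unitExp s * unitExp t := by
  rw [unitExp, mul_add, Circle.exp_add, unitExp, unitExp]

theorem unitExp_sub (s t : ℝ) : unitExp (s - t) = unitExp s / unitExp t := by
  rw [unitExp, mul_sub, Circle.exp_sub, unitExp, unitExp]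

theorem unitExp_zsmul (a : ℤ) (t : ℝ) : unitExp (a * t) = unitExp t ^ a := by
  refine Circle.ext ?_
  rw [coe_unitExp_zpow, unitExp, Circle.coe_exp]
  congr 1
  push_cast
  ring

theorem exists_mem_Icc_unitExp_eq (z : Circle) : ∃ t ∈ Set.Icc (0 : ℝ) 1, unitExp t = z := by
  refine ⟨Int.fract (Complex.arg z / (2 * Real.pi)),
    ⟨Int.fract_nonneg _, (Int.fract_lt_one _).le⟩, ?_⟩
  rw [Int.fract, unitExp_sub, unitExp_eq_one_iff.2 ⟨_, rfl⟩, div_one, unitExp,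
    mul_div_cancel₀ _ (by positivity), Circle.exp_arg]

theorem norm_unitExp_sub_one (t : ℝ) : ‖(unitExp t : ℂ) - 1‖ = 2 * |Real.sin (Real.pi * t)| := by
  rw [unitExp, Circle.coe_exp, mul_comm, Complex.norm_exp_I_mul_ofReal_sub_one, norm_mul,
    Real.norm_eq_abs, Real.norm_eq_abs, abs_two]
  congr 3
  ring

theorem norm_unitExp_sub_le (s t : ℝ) : ‖(unitExp s : ℂ) - unitExp t‖ ≤ 2 * Real.pi * |s - t| := by
  have : (unitExp s : ℂ) - unitExp t = unitExp t * ((unitExp (s - t) : ℂ) - 1) := by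
    rw [unitExp_sub, mul_sub, Circle.coe_div, mul_div_cancel₀ _ (Circle.coe_ne_zero _), mul_one]
  rw [this, norm_mul, Circle.norm_coe, one_mul, norm_unitExp_sub_one]
  have h := Real.abs_sin_le_abs (x := Real.pi * (s - t))
  rw [abs_mul, abs_of_pos Real.pi_pos] at h
  linarith

theorem distToInt_nonpos_of_eq_intCast {t : ℝ} {n : ℤ} (h : t = n) : distToInt t ≤ 0 := by
  refine (ciInf_le ⟨0, ?_⟩ n).trans (by simp [h])
  rintro _ ⟨m, rfl⟩
  exact abs_nonneg _

/-- After subtracting the nearest integer, this is Jordan's inequality for `2 * |sin (π * t)|`. -/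
theorem four_mul_distToInt_le (t : ℝ) : 4 * distToInt t ≤ ‖(unitExp t : ℂ) - 1‖ := by
  have h1 : distToInt t ≤ |t - round t| := by
    refine ciInf_le ⟨0, ?_⟩ (round t)
    rintro _ ⟨m, rfl⟩
    exact abs_nonneg _
  have h2 : unitExp t = unitExp (t - round t) := by
    rw [unitExp_sub, unitExp_eq_one_iff.2 ⟨_, rfl⟩, div_one]
  have h3 := abs_sub_round t
  rw [h2, norm_unitExp_sub_one]
  have h4 := Real.mul_abs_le_abs_sin (x := Real.pi * (t - round t)) (by
    rw [abs_mul, abs_of_pos Real.pi_pos]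
    nlinarith [Real.pi_pos])
  rw [abs_mul, abs_of_pos Real.pi_pos, ← mul_assoc, div_mul_cancel₀ _ Real.pi_ne_zero] at h4
  linarith

theorem countable_preimage_unitExp {s : Set Circle} (hs : s.Finite) :
    (unitExp ⁻¹' s).Countable := by
  rw [← Set.biUnion_preimage_singleton]
  refine hs.countable.biUnion fun z _ => ?_
  obtain ⟨t, -, rfl⟩ := exists_mem_Icc_unitExp_eq z
  refine (Set.countable_range fun n : ℤ => (n : ℝ) + t).mono fun s hs => ?_
  have h1 : unitExp (s - t) = 1 := by
    rw [unitExp_sub, show unitExp s = unitExp t from hs, div_self']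
  obtain ⟨n, hn⟩ := unitExp_eq_one_iff.1 h1
  exact ⟨n, by simp only; linarith⟩

end UnitExp

/-! ### Zeros and discontinuities of analytic functions on the circle -/

section RealAnalytic

variable {f : Circle → ℂ}

theorem IsRealAnalyticOnCircle.continuous (hf : IsRealAnalyticOnCircle f) : Continuous f := by
  rw [continuous_iff_continuousAt]
  intro z
  obtain ⟨t, -, rfl⟩ := exists_mem_Icc_unitExp_eq z
  exact continuousAt_of_comp_unitExp (hf t (Set.mem_univ t)).continuousAt

/-- Roots of unity have rational angles, and irrational angles are dense. -/
theorem ZerosAreRootsOfUnity.not_eventually_eq_zero (hz : ZerosAreRootsOfUnity f) (t : ℝ) :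
    ¬ ∀ᶠ s in 𝓝 t, f (unitExp s) = 0 := by
  intro h
  obtain ⟨U, hU, hUo, htU⟩ := eventually_nhds_iff.1 h
  obtain ⟨s, hsU, hs⟩ := dense_irrational.inter_open_nonempty U hUo ⟨t, htU⟩
  obtain ⟨k, hk, hk1⟩ := hz _ (hU s hsU)
  rw [← zpow_natCast, ← unitExp_zsmul] at hk1
  obtain ⟨n, hn⟩ := unitExp_eq_one_iff.1 hk1
  refine hs ⟨(n : ℚ) / k, ?_⟩
  have : (k : ℝ) ≠ 0 := by exact_mod_cast hk.ne'
  push_cast at hn ⊢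
  rw [← hn]
  field_simp

/-- Locally this is factorization at a zero of finite order. Compactness glues the pieces by
multiplying their products; each superfluous factor is at most `2`, so counting a zero too often
only lowers `c`. -/
theorem IsRealAnalyticOnCircle.exists_prod_le_norm (hf : IsRealAnalyticOnCircle f)
    (hz : ZerosAreRootsOfUnity f) : ∃ M : Multiset Circle, (∀ a ∈ M, f a = 0) ∧
      ∃ c : ℝ, 0 < c ∧ ∀ z : Circle, c * (M.map fun a : Circle => ‖(z : ℂ) - a‖).prod ≤ ‖f z‖ := by
  have hprod0 : ∀ (M : Multiset Circle) (z : Circle),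
      0 ≤ (M.map fun a : Circle => ‖(z : ℂ) - a‖).prod := fun M z =>
    Multiset.prod_nonneg fun _ h => by
      obtain ⟨a, -, rfl⟩ := Multiset.mem_map.1 h
      exact norm_nonneg _
  have hprod2 : ∀ (M : Multiset Circle) (z : Circle),
      (M.map fun a : Circle => ‖(z : ℂ) - a‖).prod ≤ 2 ^ M.card := by
    intro M z
    induction M using Multiset.induction_on with
    | empty => simp
    | cons a M ih =>
      rw [Multiset.map_cons, Multiset.prod_cons, Multiset.card_cons, pow_succ']
      exact mul_le_mul (Circle.norm_sub_le_two _ _) ih (hprod0 M z) (by norm_num)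
  have key : ∃ M : Multiset Circle, (∀ a ∈ M, f a = 0) ∧ ∃ c : ℝ, 0 < c ∧
      ∀ t ∈ Set.Icc (0 : ℝ) 1, c * (M.map fun a : Circle => ‖(unitExp t : ℂ) - a‖).prod
        ≤ ‖f (unitExp t)‖ := by
    refine (isCompact_Icc (a := (0 : ℝ)) (b := 1)).induction_on
      (p := fun s => ∃ M : Multiset Circle, (∀ a ∈ M, f a = 0) ∧ ∃ c : ℝ, 0 < c ∧
        ∀ t ∈ s, c * (M.map fun a : Circle => ‖(unitExp t : ℂ) - a‖).prod
          ≤ ‖f (unitExp t)‖) ?_ ?_ ?_ ?_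
    · exact ⟨0, by simp, 1, one_pos, by simp⟩
    · rintro s t hst ⟨M, hM, c, hc, h⟩
      exact ⟨M, hM, c, hc, fun u hu => h u (hst hu)⟩
    · rintro s t ⟨M, hM, c, hc, h⟩ ⟨N, hN, d, hd, h'⟩
      refine ⟨M + N, fun a ha => (Multiset.mem_add.1 ha).elim (hM a) (hN a),
        min (c / 2 ^ N.card) (d / 2 ^ M.card), by positivity, ?_⟩
      rintro u (hu | hu)
      · refine le_trans ?_ (h u hu)
        rw [Multiset.map_add, Multiset.prod_add]
        calc _ ≤ c / 2 ^ N.card *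
                ((M.map fun a : Circle => ‖(unitExp u : ℂ) - a‖).prod * 2 ^ N.card) :=
              mul_le_mul (min_le_left _ _)
                (mul_le_mul_of_nonneg_left (hprod2 _ _) (hprod0 _ _))
                (mul_nonneg (hprod0 _ _) (hprod0 _ _)) (by positivity)
          _ = _ := by field_simp
      · refine le_trans ?_ (h' u hu)
        rw [Multiset.map_add, Multiset.prod_add]
        calc _ ≤ d / 2 ^ M.card *
                (2 ^ M.card * (N.map fun a : Circle => ‖(unitExp u : ℂ) - a‖).prod) :=
              mul_le_mul (min_le_right _ _)
                (mul_le_mul_of_nonneg_right (hprod2 _ _) (hprod0 _ _))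
                (mul_nonneg (hprod0 _ _) (hprod0 _ _)) (by positivity)
          _ = _ := by field_simp
    · intro t _
      obtain ⟨n, g, hg, hg0, hfg⟩ :=
        (hf t (Set.mem_univ t)).exists_eventuallyEq_pow_smul_nonzero_iff.2
        (hz.not_eventually_eq_zero t)
      have hgn : 0 < ‖g t‖ := norm_pos_iff.2 hg0
      have hev : ∀ᶠ s in 𝓝 t, ‖g t‖ / 2 < ‖g s‖ ∧ f (unitExp s) = (s - t) ^ n • g s :=
        (hg.continuousAt.norm.eventually_const_lt (by linarith)).and hfg
      -- The chord satisfies `‖unitExp s - unitExp t‖ ≤ 2 * π * |s - t|`, whence `(2 * π) ^ n`; if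
      -- `f` is nonzero at the point, then `n = 0` is possible and the multiset is empty.
      refine ⟨_, mem_nhdsWithin_of_mem_nhds hev, Multiset.replicate n (unitExp t), ?_,
        ‖g t‖ / 2 / (2 * Real.pi) ^ n, by positivity, ?_⟩
      · intro a ha
        obtain ⟨hn, rfl⟩ := Multiset.mem_replicate.1 ha
        rw [hfg.self_of_nhds, sub_self, zero_pow hn, zero_smul]
      · rintro s ⟨h1, h2⟩
        rw [h2, Multiset.map_replicate, Multiset.prod_replicate, norm_smul, norm_pow,
          Real.norm_eq_abs]
        calc _ ≤ ‖g t‖ / 2 / (2 * Real.pi) ^ n * (2 * Real.pi * |s - t|) ^ n := by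
              gcongr
              exact norm_unitExp_sub_le s t
          _ = |s - t| ^ n * (‖g t‖ / 2) := by
            rw [mul_pow (2 * Real.pi) |s - t|]
            field_simp
          _ ≤ _ := by gcongr
  obtain ⟨M, hM, c, hc, h⟩ := key
  refine ⟨M, hM, c, hc, fun z => ?_⟩
  obtain ⟨t, ht, rfl⟩ := exists_mem_Icc_unitExp_eq z
  exact h t ht

theorem IsRealAnalyticOnCircle.exists_abs_log_norm_le (hf : IsRealAnalyticOnCircle f)
    (hz : ZerosAreRootsOfUnity f) : ∃ M : Multiset Circle, (∀ a ∈ M, f a = 0) ∧ ∃ C : ℝ,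
      ∀ z : Circle,
        |Real.log ‖f z‖| ≤ C + (M.map fun a : Circle => |Real.log ‖(z : ℂ) - a‖|).sum := by
  obtain ⟨M, hM, c, hc, h⟩ := hf.exists_prod_le_norm hz
  obtain ⟨D, hD⟩ := isCompact_univ.exists_bound_of_continuousOn hf.continuous.continuousOn
  have hlog : ∀ (N : Multiset Circle) (z : Circle), (∀ a ∈ N, a ≠ z) →
      0 < (N.map fun a : Circle => ‖(z : ℂ) - a‖).prod ∧
      -(N.map fun a : Circle => |Real.log ‖(z : ℂ) - a‖|).sum
        ≤ Real.log (N.map fun a : Circle => ‖(z : ℂ) - a‖).prod := by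
    intro N z
    induction N using Multiset.induction_on with
    | empty => simp
    | cons a N ih =>
      intro hN
      obtain ⟨h1, h2⟩ := ih fun b hb => hN b (Multiset.mem_cons_of_mem hb)
      have h3 : 0 < ‖(z : ℂ) - a‖ := norm_pos_iff.2 <| sub_ne_zero.2 fun h =>
        hN a (Multiset.mem_cons_self a N) (Circle.ext h.symm)
      simp only [Multiset.map_cons, Multiset.prod_cons, Multiset.sum_cons]
      refine ⟨mul_pos h3 h1, ?_⟩
      rw [Real.log_mul h3.ne' h1.ne']
      linarith [neg_abs_le (Real.log ‖(z : ℂ) - a‖)]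
  have hsum0 : ∀ z : Circle, 0 ≤ (M.map fun a : Circle => |Real.log ‖(z : ℂ) - a‖|).sum := fun z =>
    Multiset.sum_nonneg fun _ h => by
      obtain ⟨a, -, rfl⟩ := Multiset.mem_map.1 h
      exact abs_nonneg _
  refine ⟨M, hM, |Real.log c| + |Real.log D|, fun z => ?_⟩
  have hs := hsum0 z
  by_cases hfz : f z = 0
  -- At a zero of `f` the convention `log 0 = 0` makes the bound trivial.
  · rw [hfz, norm_zero, Real.log_zero, abs_zero]
    positivity
  · obtain ⟨h1, h2⟩ := hlog M z fun a ha haz => hfz (haz ▸ hM a ha)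
    have h3 := Real.log_le_log (mul_pos hc h1) (h z)
    rw [Real.log_mul hc.ne' h1.ne'] at h3
    have h4 := Real.log_le_log (norm_pos_iff.2 hfz) (hD z (Set.mem_univ z))
    rw [abs_le]
    constructor <;> linarith [neg_abs_le (Real.log c), le_abs_self (Real.log D),
      abs_nonneg (Real.log c), abs_nonneg (Real.log D)]

theorem IsRealAnalyticOnCircle.eventually_ne_zero (hf : IsRealAnalyticOnCircle f)
    (hz : ZerosAreRootsOfUnity f) (t : ℝ) : ∀ᶠ s in 𝓝[≠] t, f (unitExp s) ≠ 0 :=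
  (hf t (Set.mem_univ t)).eventually_eq_zero_or_eventually_ne_zero.resolve_left
    (hz.not_eventually_eq_zero t)

theorem IsRealAnalyticOnCircle.eventually_continuousAt_log (hf : IsRealAnalyticOnCircle f)
    (hz : ZerosAreRootsOfUnity f) (t : ℝ) :
    ∀ᶠ s in 𝓝[≠] t, ContinuousAt (fun z => Real.log ‖f z‖) (unitExp s) := by
  filter_upwards [hf.eventually_ne_zero hz t] with s hs
  exact hf.continuous.continuousAt.norm.log (norm_ne_zero_iff.2 hs)

/-- Zeros of the analytic function `im f` are isolated unless it vanishes near `t`. In the latter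
case `f` is real and nonzero near `t` off `t`, so it stays on one half-axis locally and its argument
does not jump. -/
theorem IsRealAnalyticOnCircle.eventually_continuousAt_arg (hf : IsRealAnalyticOnCircle f)
    (hz : ZerosAreRootsOfUnity f) (t : ℝ) :
    ∀ᶠ s in 𝓝[≠] t, ContinuousAt (fun z => Complex.arg (f z)) (unitExp s) := by
  have him : AnalyticAt ℝ (fun s => (f (unitExp s)).im) t :=
    (Complex.imCLM.analyticAt _).comp (hf t (Set.mem_univ t))
  have hslit : ∀ s, f (unitExp s) ∈ Complex.slitPlane →
      ContinuousAt (fun z => Complex.arg (f z)) (unitExp s) := fun s hs =>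
    (Complex.continuousAt_arg hs).comp hf.continuous.continuousAt
  rcases him.eventually_eq_zero_or_eventually_ne_zero with h | h
  · filter_upwards [hf.eventually_ne_zero hz t,
      mem_nhdsWithin_of_mem_nhds (eventually_eventually_nhds.2 h)] with s hs hs'
    have hs0 : (f (unitExp s)).im = 0 := hs'.self_of_nhds
    rcases lt_trichotomy (f (unitExp s)).re 0 with hre | hre | hre
    · refine continuousAt_of_comp_unitExp
        ((continuousAt_const (y := Real.pi)).congr ?_)
      have hc : ContinuousAt (fun u => (f (unitExp u)).re) s :=
        (Complex.continuous_re.comp (hf.continuous.comp continuous_unitExp)).continuousAt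
      filter_upwards [hs', hc.eventually_lt_const hre] with u hu hu'
      exact (Complex.arg_eq_pi_iff.2 ⟨hu', hu⟩).symm
    · exact absurd (Complex.ext hre hs0) hs
    · exact hslit s (Or.inl hre)
  · filter_upwards [h] with s hs using hslit s (Or.inr hs)

end RealAnalytic

/-- Compactness leaves finitely many discontinuities; `ρ` is the product of the distances to them.
-/
theorem exists_continuous_of_eventually_continuousAt {g : Circle → ℝ}
    (hg : ∀ t : ℝ, ∀ᶠ s in 𝓝[≠] t, ContinuousAt g (unitExp s)) :
    ∃ ρ : Circle → ℝ, Continuous ρ ∧ (∀ z, 0 ≤ ρ z) ∧ {z | ρ z = 0}.Finite ∧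
      ∀ z, ρ z ≠ 0 → ContinuousAt g z := by
  have hfin : (Set.Icc (0 : ℝ) 1 ∩ {s | ¬ ContinuousAt g (unitExp s)}).Finite := by
    refine isCompact_Icc.induction_on
      (p := fun U => (U ∩ {s | ¬ ContinuousAt g (unitExp s)}).Finite) (by simp)
      (fun s t hst h => h.subset (Set.inter_subset_inter_left _ hst))
      (fun s t hs ht => by rw [Set.union_inter_distrib_right]; exact hs.union ht) ?_
    intro t _
    have h := eventually_nhdsWithin_iff.1 (hg t)
    refine ⟨_, mem_nhdsWithin_of_mem_nhds h, (Set.finite_singleton t).subset ?_⟩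
    rintro s ⟨h1, h2⟩
    by_contra hst
    exact h2 (h1 hst)
  set B := (hfin.image unitExp).toFinset with hB
  refine ⟨fun z => ∏ b ∈ B, ‖(z : ℂ) - b‖, by fun_prop,
    fun z => Finset.prod_nonneg fun b _ => norm_nonneg _,
    B.finite_toSet.subset fun z hz => ?_, fun z hz => ?_⟩
  · obtain ⟨b, hb, hb0⟩ := Finset.prod_eq_zero_iff.1 hz
    rwa [Circle.ext (sub_eq_zero.1 (norm_eq_zero.1 hb0))]
  · by_contra hcont
    obtain ⟨t, ht, rfl⟩ := exists_mem_Icc_unitExp_eq z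
    refine hz (Finset.prod_eq_zero (i := unitExp t) ?_ (by simp))
    rw [hB, Set.Finite.mem_toFinset]
    exact ⟨t, ⟨ht, hcont⟩, rfl⟩

/-! ### Consequences of finite type -/

section FiniteType

theorem IsFiniteType.unitExp_zpow_mul_zpow_ne_one {φ₁ φ₂ : ℝ} (hφ : IsFiniteType ![φ₁, φ₂])
    (a b : ℤ) (hab : (a, b) ≠ 0) : unitExp φ₁ ^ a * unitExp φ₂ ^ b ≠ 1 := by
  obtain ⟨K, γ, hK, -, h⟩ := hφ
  intro h1
  rw [← unitExp_zsmul, ← unitExp_zsmul, ← unitExp_add] at h1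
  obtain ⟨n, hn⟩ := unitExp_eq_one_iff.1 h1
  have hq : ![a, b] ≠ 0 := fun hq => hab (Prod.ext (congrFun hq 0) (congrFun hq 1))
  have h2 := h ![a, b] hq
  have h3 : ∑ j, ((![a, b] j : ℤ) : ℝ) * ![φ₁, φ₂] j = n := by
    simpa [Fin.sum_univ_two] using hn
  have h4 : 0 < ‖![a, b]‖ := norm_pos_iff.2 hq
  exact absurd (h2.trans (distToInt_nonpos_of_eq_intCast h3)) (not_le.2 (by positivity))

theorem isDiophantine_unitExp {φ K γ : ℝ} (hK : 0 < K)
    (h : ∀ n : ℕ, 1 ≤ n → K / (n : ℝ) ^ γ ≤ distToInt (n * φ)) : IsDiophantine (unitExp φ) := by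
  refine ⟨K, ⌈γ⌉₊, hK, fun n hn => ?_⟩
  have hn1 : (1 : ℝ) ≤ n := by exact_mod_cast hn
  have h1 : (unitExp φ : ℂ) ^ n = unitExp (n * φ) := by
    have := unitExp_zsmul n φ
    rw [Int.cast_natCast, zpow_natCast] at this
    rw [this, Circle.coe_pow]
  -- Since `n ≥ 1`, rounding the exponent up to a natural number only weakens the bound.
  have h2 : K / (n : ℝ) ^ ⌈γ⌉₊ ≤ K / (n : ℝ) ^ γ := by
    rw [← Real.rpow_natCast]
    gcongr
    exact Nat.le_ceil γ
  have h3 := h n hn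
  have h4 : 0 ≤ K / (n : ℝ) ^ γ := by positivity
  rw [h1]
  linarith [four_mul_distToInt_le (n * φ)]

theorem IsFiniteType.isDiophantine {d : ℕ} {φ : Fin d → ℝ} (hφ : IsFiniteType φ) (i : Fin d) :
    IsDiophantine (unitExp (φ i)) := by
  obtain ⟨K, γ, hK, -, h⟩ := hφ
  refine isDiophantine_unitExp (γ := γ) hK fun n hn => ?_
  have h1 := h (Pi.single i (n : ℤ)) (by
    rw [Ne, Pi.single_eq_zero_iff]
    omega)
  rw [Pi.norm_single, Int.norm_natCast, Finset.sum_eq_single i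
    (fun j _ hj => by rw [Pi.single_eq_of_ne hj, Int.cast_zero, zero_mul]) (by simp),
    Pi.single_eq_same, Int.cast_natCast] at h1
  exact h1

end FiniteType

/-! ### Convergence of the averages -/

section Averages

variable {f : Circle → ℂ} {x : Circle}

theorem IsDiophantine.map_pow_ne_zero (hx : IsDiophantine x) (hz : ZerosAreRootsOfUnity f) {n : ℕ}
    (hn : 1 ≤ n) : f (x ^ n) ≠ 0 := by
  intro h
  obtain ⟨k, hk, hk1⟩ := hz _ h
  obtain ⟨K, γ, hK, hx⟩ := hx
  have h1 := hx (n * k) (Nat.mul_pos hn hk)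
  rw [← Circle.coe_pow, pow_mul, hk1, Circle.coe_one, sub_self, norm_zero] at h1
  have h2 : (0 : ℝ) < (n * k : ℕ) := by exact_mod_cast Nat.mul_pos hn hk
  exact absurd h1 (not_le.2 (by positivity))

theorem IsDiophantine.isBigO_log_norm (hx : IsDiophantine x) (hf : IsRealAnalyticOnCircle f)
    (hz : ZerosAreRootsOfUnity f) :
    (fun n : ℕ => Real.log ‖f (x ^ n)‖) =O[atTop] (fun n : ℕ => Real.log (n : ℝ)) := by
  obtain ⟨M, hM, C, h⟩ := hf.exists_abs_log_norm_le hz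
  have hsum : ∀ N : Multiset Circle, (∀ a ∈ N, f a = 0) →
      (fun n : ℕ => (N.map fun a : Circle => |Real.log ‖((x ^ n : Circle) : ℂ) - a‖|).sum)
        =O[atTop] (fun n : ℕ => Real.log (n : ℝ)) := by
    intro N
    induction N using Multiset.induction_on with
    | empty => exact fun _ => by simpa using Asymptotics.isBigO_zero _ _
    | cons a N ih =>
      intro hN
      obtain ⟨k, hk, hk1⟩ := hz a (hN a (Multiset.mem_cons_self a N))
      simp only [Multiset.map_cons, Multiset.sum_cons]
      exact (hx.isBigO_log_norm_pow_sub hk hk1).add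
        (ih fun b hb => hN b (Multiset.mem_cons_of_mem hb))
  have hconst : (fun _ : ℕ => C) =O[atTop] (fun n : ℕ => Real.log (n : ℝ)) :=
    (Asymptotics.isLittleO_const_left.2 <| Or.inr <| tendsto_norm_atTop_atTop.comp <|
      Real.tendsto_log_atTop.comp tendsto_natCast_atTop_atTop).isBigO
  refine (Asymptotics.IsBigO.of_bound 1 (Eventually.of_forall fun n => ?_)).trans
    (hconst.add (hsum M hM))
  rw [one_mul, Real.norm_eq_abs]
  exact (h _).trans (le_abs_self _)

theorem IsDiophantine.hasBoundedFourthMoments_log_norm (hx : IsDiophantine x)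
    (hf : IsRealAnalyticOnCircle f) (hz : ZerosAreRootsOfUnity f) :
    HasBoundedFourthMoments x (fun z => Real.log ‖f z‖) := by
  obtain ⟨M, hM, C, h⟩ := hf.exists_abs_log_norm_le hz
  have hsum : ∀ N : Multiset Circle, (∀ a ∈ N, f a = 0) → HasBoundedFourthMoments x
      (fun z => (N.map fun a : Circle => |Real.log ‖(z : ℂ) - a‖|).sum) := by
    intro N
    induction N using Multiset.induction_on with
    | empty => exact fun _ => by simpa using HasBoundedFourthMoments.const x 0
    | cons a N ih =>
      intro hN
      obtain ⟨k, hk, hk1⟩ := hz a (hN a (Multiset.mem_cons_self a N))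
      simp only [Multiset.map_cons, Multiset.sum_cons]
      exact (hx.hasBoundedFourthMoments_log hk hk1).add
        (ih fun b hb => hN b (Multiset.mem_cons_of_mem hb))
  exact ((HasBoundedFourthMoments.const x C).add (hsum M hM)).mono h

theorem hasBoundedFourthMoments_arg (x : Circle) (f : Circle → ℂ) :
    HasBoundedFourthMoments x (fun z => Complex.arg (f z)) :=
  (HasBoundedFourthMoments.const x Real.pi).mono fun _ => Complex.abs_arg_le_pi _

theorem ae_volume_comp_unitExp_ne_zero {ρ : Circle → ℝ} (hρ : {z | ρ z = 0}.Finite) :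
    ∀ᵐ t : ℝ, ρ (unitExp t) ≠ 0 := by
  have h := (countable_preimage_unitExp hρ).measure_zero volume
  rw [ae_iff]
  simpa using h

/-- If two points of the circle have jointly equidistributed powers, then averages of products of
functions with bounded fourth moments and finitely many discontinuities converge. -/
theorem averageConvergesToIntegral_of_isEquidistributed {x y : Circle} {g h : Circle → ℝ}
    (hxy : IsEquidistributed (fun m => (x ^ m, y ^ m)) torusMeasure)
    (hgc : ∀ t : ℝ, ∀ᶠ s in 𝓝[≠] t, ContinuousAt g (unitExp s))
    (hhc : ∀ t : ℝ, ∀ᶠ s in 𝓝[≠] t, ContinuousAt h (unitExp s))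
    (hg : HasBoundedFourthMoments x g) (hh : HasBoundedFourthMoments y h) :
    AverageConvergesToIntegral g h x y := by
  obtain ⟨ρ, hρ, hρ0, hρf, hρg⟩ := exists_continuous_of_eventually_continuousAt hgc
  obtain ⟨σ, hσ, hσ0, hσf, hσh⟩ := exists_continuous_of_eventually_continuousAt hhc
  obtain ⟨C, hC⟩ := hg
  obtain ⟨D, hD⟩ := hh
  have hc : Continuous fun z : Circle × Circle => ρ z.1 * σ z.2 :=
    (hρ.comp continuous_fst).mul (hσ.comp continuous_snd)
  have hmeas0 : MeasurableSet {z : Circle × Circle | ρ z.1 * σ z.2 ≠ 0} :=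
    (isOpen_ne_fun hc continuous_const).measurableSet
  -- Each factor vanishes at finitely many points of the circle, hence at countably many angles.
  have hnull : ∀ᵐ z ∂torusMeasure, ρ z.1 * σ z.2 ≠ 0 := by
    rw [torusMeasure, ae_map_iff continuous_torusExp.measurable.aemeasurable hmeas0]
    refine ae_restrict_of_ae ?_
    rw [Measure.volume_eq_prod]
    filter_upwards [Measure.quasiMeasurePreserving_fst.ae (ae_volume_comp_unitExp_ne_zero hρf),
      Measure.quasiMeasurePreserving_snd.ae (ae_volume_comp_unitExp_ne_zero hσf)] with p h1 h2
    exact mul_ne_zero h1 h2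
  -- Fourth moments enter through `(g * h) ^ 2 ≤ g ^ 4 + h ^ 4`; the absolute values keep the bound
  -- nonnegative at `n = 0`.
  have hmoment : ∀ n, empiricalMean (fun m => (x ^ m, y ^ m))
      (fun z => (g z.1 * h z.2) ^ 2) n ≤ |C| + |D| := by
    intro n
    rcases Nat.eq_zero_or_pos n with rfl | hn
    · simp only [empiricalMean, CharP.cast_eq_zero, div_zero, zero_mul]
      positivity
    · have hn' : (0 : ℝ) < n := by exact_mod_cast hn
      rw [empiricalMean, one_div_mul_eq_div, div_le_iff₀ hn']
      calc ∑ m ∈ Finset.Icc 1 n, (g (x ^ m) * h (y ^ m)) ^ 2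
          ≤ ∑ m ∈ Finset.Icc 1 n, (g (x ^ m) ^ 4 + h (y ^ m) ^ 4) := by
            refine Finset.sum_le_sum fun m _ => ?_
            nlinarith [sq_nonneg (g (x ^ m) ^ 2 - h (y ^ m) ^ 2), sq_nonneg (g (x ^ m) ^ 2),
              sq_nonneg (h (y ^ m) ^ 2)]
        _ ≤ C * n + D * n := by rw [Finset.sum_add_distrib]; exact add_le_add (hC n) (hD n)
        _ ≤ (|C| + |D|) * n := by
            rw [add_mul]
            gcongr
            · exact le_abs_self C
            · exact le_abs_self D
  obtain ⟨h1, h2⟩ := hxy.integrable_and_tendsto (G := fun z => g z.1 * h z.2) hc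
    (fun z => mul_nonneg (hρ0 _) (hσ0 _))
    (fun z hz => ((hρg _ (left_ne_zero_of_mul hz)).comp continuousAt_fst).mul
      ((hσh _ (right_ne_zero_of_mul hz)).comp continuousAt_snd)) hnull hmoment
  have hmeas := continuous_torusExp.measurable.aemeasurable
    (μ := (volume : Measure (ℝ × ℝ)).restrict unitSquare)
  refine ⟨(integrable_map_measure h1.aestronglyMeasurable hmeas).1 h1, ?_⟩
  rw [torusMeasure, integral_map hmeas h1.aestronglyMeasurable] at h2
  exact h2

end Averages

theorem mainTheorem9 (f₁ f₂ : Circle → ℂ) (φ₁ φ₂ : ℝ) (x₁ x₂ : Circle)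
    (hf₁ : IsRealAnalyticOnCircle f₁) (hf₂ : IsRealAnalyticOnCircle f₂)
    (hz₁ : ZerosAreRootsOfUnity f₁) (hz₂ : ZerosAreRootsOfUnity f₂)
    (hx₁ : x₁ = unitExp φ₁) (hx₂ : x₂ = unitExp φ₂)
    (hφ : IsFiniteType ![φ₁, φ₂]) :
    (∀ n : ℕ, 1 ≤ n → f₁ (x₁ ^ n) ≠ 0 ∧ f₂ (x₂ ^ n) ≠ 0) ∧
    (fun n : ℕ => Real.log ‖f₁ (x₁ ^ n)‖) =O[atTop] (fun n : ℕ => Real.log (n : ℝ)) ∧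
    (fun n : ℕ => Real.log ‖f₂ (x₂ ^ n)‖) =O[atTop] (fun n : ℕ => Real.log (n : ℝ)) ∧
    AverageConvergesToIntegral
      (fun z => Real.log ‖f₁ z‖) (fun z => Real.log ‖f₂ z‖) x₁ x₂ ∧
    AverageConvergesToIntegral
      (fun z => Complex.arg (f₁ z)) (fun z => Real.log ‖f₂ z‖) x₁ x₂ ∧
    AverageConvergesToIntegral
      (fun z => Real.log ‖f₁ z‖) (fun z => Complex.arg (f₂ z)) x₁ x₂ ∧
    AverageConvergesToIntegral
      (fun z => Complex.arg (f₁ z)) (fun z => Complex.arg (f₂ z)) x₁ x₂ := by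
  subst hx₁ hx₂
  have hd₁ : IsDiophantine (unitExp φ₁) := hφ.isDiophantine 0
  have hd₂ : IsDiophantine (unitExp φ₂) := hφ.isDiophantine 1
  have heq := isEquidistributed_pow hφ.unitExp_zpow_mul_zpow_ne_one
  have hl₁ := hd₁.hasBoundedFourthMoments_log_norm hf₁ hz₁
  have hl₂ := hd₂.hasBoundedFourthMoments_log_norm hf₂ hz₂
  have ha₁ := hasBoundedFourthMoments_arg (unitExp φ₁) f₁
  have ha₂ := hasBoundedFourthMoments_arg (unitExp φ₂) f₂
  have cl₁ := hf₁.eventually_continuousAt_log hz₁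
  have cl₂ := hf₂.eventually_continuousAt_log hz₂
  have ca₁ := hf₁.eventually_continuousAt_arg hz₁
  have ca₂ := hf₂.eventually_continuousAt_arg hz₂
  exact ⟨fun n hn => ⟨hd₁.map_pow_ne_zero hz₁ hn, hd₂.map_pow_ne_zero hz₂ hn⟩,
    hd₁.isBigO_log_norm hf₁ hz₁, hd₂.isBigO_log_norm hf₂ hz₂,
    averageConvergesToIntegral_of_isEquidistributed heq cl₁ cl₂ hl₁ hl₂,
    averageConvergesToIntegral_of_isEquidistributed heq ca₁ cl₂ ha₁ hl₂,
    averageConvergesToIntegral_of_isEquidistributed heq cl₁ ca₂ hl₁ ha₂,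
    averageConvergesToIntegral_of_isEquidistributed heq ca₁ ca₂ ha₁ ha₂⟩
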